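/- Let $\mathbb K\in\{\mathbb R,\mathbb C\}$, let $X$ be a Hausdorff locally convex topological vector space over $\mathbb K$ (of any dimension, not assumed complete), and let $T:X\to X$ be a continuous linear bijection with continuous inverse. Suppose that $T$ is topologically stable, that is: for every neighborhood $V$ of $0$ there is a neighborhood $U$ of $0$ such that for every (not necessarily linear) homeomorphism $S:X\to X$ with $Tx-Sx\in U$ for all $x\in X$ there is a continuous map $\phi:X\to X$ with $T\circ\phi=\phi\circ S$ and $\phi(x)-x\in V$ for all $x\in X$. Then: (a) $T$ has the finite shadowing property: for every neighborhood $V$ of $0$ there is a neighborhood $U$ of $0$ such that for every $k\ge 1$ and every finite sequence $(x_j)_{j=0}^{k}$ in $X$ with $Tx_j-x_{j+1}\in U$ for $0\le j<k$ there is $a\in X$ with $x_j-T^ja\in V$ for all $0\le j\le k$. (b) $T$ has the strict periodic shadowing property: for every neighborhood $V$ of $0$ there is a neighborhood $U$ of $0$ such that for every $k\ge 1$ and every sequence $(x_j)_{j\ge 0}$ in $X$ with $Tx_j-x_{j+1}\in U$ and $x_{j+k}=x_j$ for all $j\ge 0$ there is $a\in X$ with $T^ka=a$ and $x_j-T^ja\in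 V$ for all $j\ge 0$. -/

import Mathlib

open Topology

namespace LinearDynamics

section Shadowing

variable {𝕜 X : Type*} [RCLike 𝕜] [AddCommGroup X] [Module 𝕜 X] [TopologicalSpace X]

/-- `(x 0, …, x k)` is a `U`-chain for `T` (it has at least two terms). Only the values
`x 0, …, x k` matter. -/
def IsChain (T : X →L[𝕜] X) (U : Set X) (k : ℕ) (x : ℕ → X) : Prop :=
  1 ≤ k ∧ ∀ j < k, T (x j) - x (j + 1) ∈ U

/-- `(x j)`, `j ∈ ℕ`, is an infinite `U`-pseudotrajectory of `T`. -/
def IsPseudotrajectory (T : X →L[𝕜] X) (U : Set X) (x : ℕ → X) : Prop :=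
  ∀ j, T (x j) - x (j + 1) ∈ U

/-- The finite shadowing property: for every neighborhood `V` of `0` there is a neighborhood `U`
of `0` such that every `U`-chain (of any length) is `V`-shadowed by the trajectory of a point. -/
def FiniteShadowingProperty (T : X →L[𝕜] X) : Prop :=
  ∀ V ∈ 𝓝 (0 : X), ∃ U ∈ 𝓝 (0 : X), ∀ (k : ℕ) (x : ℕ → X), IsChain T U k x →
    ∃ a : X, ∀ j ≤ k, x j - T^[j] a ∈ V

/-- The strict periodic shadowing property: for every neighborhood `V` of `0` there is a
neighborhood `U` of `0` such that every `U`-pseudotrajectory with period `k ≥ 1` is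
`V`-shadowed by the trajectory of a point `a` with `T^k a = a`. -/
def StrictPeriodicShadowingProperty (T : X →L[𝕜] X) : Prop :=
  ∀ V ∈ 𝓝 (0 : X), ∃ U ∈ 𝓝 (0 : X), ∀ (k : ℕ) (x : ℕ → X), 1 ≤ k →
    IsPseudotrajectory T U x → (∀ j, x (j + k) = x j) →
    ∃ a : X, T^[k] a = a ∧ ∀ j, x j - T^[j] a ∈ V

/-- Topological stability of an invertible operator. The perturbation `S` ranges over all
(not necessarily linear) homeomorphisms of `X` onto itself. -/
def TopologicallyStable (T : X ≃L[𝕜] X) : Prop :=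
  ∀ V ∈ 𝓝 (0 : X), ∃ U ∈ 𝓝 (0 : X), ∀ S : X ≃ₜ X, (∀ x, T x - S x ∈ U) →
    ∃ φ : X → X, Continuous φ ∧ (∀ x, T (φ x) = φ (S x)) ∧ ∀ x, φ x - x ∈ V

end Shadowing

end LinearDynamics

set_option linter.unusedSectionVars false

/-! A pseudo-orbit of `T` becomes a true orbit of a perturbation `S = h ∘ T` once `h` is near the
identity and moves each `T (x j)` to the next term; the map `φ` given by stability then carries this
`S`-orbit to a nearby `T`-orbit. Only the real structure matters. In real dimension at least two
such an `h` exists after a small perturbation of the points: two shears in transversal directions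
suffice (`exists_homeomorph_interpolation`, used in `exists_shadow`). Chains and periodic
pseudo-orbits differ only in the index map, successor or cyclic shift. On a line homeomorphisms are
monotone and this fails. There `T` is multiplication by some `c`; stability excludes `|c| = 1`, and
shadowing is a direct estimate. -/

namespace LinearDynamics

/-! ### Interpolation by curves in a convex set -/

section Interpolation

variable {E : Type*} [AddCommGroup E] [Module ℝ E] [TopologicalSpace E] [ContinuousAdd E]
  [ContinuousSMul ℝ E]

/-- Finitely many values in a convex set can be interpolated by a continuous curve which stays in
that set. -/
theorem exists_continuous_interpolation {ι : Type*} {C : Set E} (hC : Convex ℝ C)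
    (hne : C.Nonempty) (F : Finset ι) (s : ι → ℝ) (v : ι → E) (hs : Set.InjOn s F)
    (hv : ∀ i ∈ F, v i ∈ C) :
    ∃ g : ℝ → E, Continuous g ∧ (∀ t, g t ∈ C) ∧ ∀ i ∈ F, g (s i) = v i := by
  classical
  induction F using Finset.induction_on with
  | empty =>
    obtain ⟨c, hc⟩ := hne
    exact ⟨fun _ => c, continuous_const, fun _ => hc, by simp⟩
  | insert a F ha ih =>
    obtain ⟨g, hg, hgC, hgF⟩ := ih (hs.mono (by simp)) fun i hi => hv i (by simp [hi])
    have hdisj : Disjoint (s '' F) {s a} := by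
      rw [Set.disjoint_singleton_right]
      rintro ⟨i, hi, hia⟩
      have : i = a := hs (by simp [Finset.mem_coe.1 hi]) (by simp) hia
      exact ha (this ▸ hi)
    obtain ⟨χ, h0, h1, h01⟩ := exists_continuous_zero_one_of_isClosed
      (F.finite_toSet.image s).isClosed isClosed_singleton hdisj
    refine ⟨fun t => (1 - χ t) • g t + χ t • v a, by fun_prop, fun t => ?_, fun i hi => ?_⟩
    · exact hC (hgC t) (hv a (by simp)) (by linarith [(h01 t).2]) (h01 t).1 (by ring)
    · rcases Finset.mem_insert.1 hi with rfl | hi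
      · have : χ (s i) = 1 := h1 rfl
        simp [this]
      · have : χ (s i) = 0 := h0 ⟨i, hi, rfl⟩
        simp [this, hgF i hi]

end Interpolation

/-! ### Homeomorphisms near the identity -/

section RealSpace

variable {X : Type*} [AddCommGroup X] [Module ℝ X] [TopologicalSpace X] [IsTopologicalAddGroup X]
  [ContinuousSMul ℝ X]

/-- The nonlinear shear `x ↦ x + g (f x)` along the kernel of `f`. -/
def shear (f : X →L[ℝ] ℝ) (g : ℝ → X) (hg : Continuous g) (hfg : ∀ t, f (g t) = 0) : X ≃ₜ X where
  toFun x := x + g (f x)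
  invFun x := x - g (f x)
  left_inv x := by simp [hfg]
  right_inv x := by simp [hfg]
  continuous_toFun := by fun_prop
  continuous_invFun := by fun_prop

theorem shear_apply (f : X →L[ℝ] ℝ) (g : ℝ → X) (hg : Continuous g) (hfg : ∀ t, f (g t) = 0)
    (x : X) : shear f g hg hfg x = x + g (f x) := rfl

theorem exists_smul_mem_of_mem_nhds_zero {N : Set X} (hN : N ∈ 𝓝 (0 : X)) (u : X) :
    ∃ δ > 0, ∀ c : ℝ, |c| < δ → c • u ∈ N := by
  have h : Filter.Tendsto (fun c : ℝ => c • u) (𝓝 0) (𝓝 0) := by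
    have : Continuous fun c : ℝ => c • u := by fun_prop
    simpa using this.tendsto 0
  obtain ⟨δ, hδ, hs⟩ := Metric.mem_nhds_iff.1 (h hN)
  exact ⟨δ, hδ, fun c hc => hs (by simpa using hc)⟩

/-- A homeomorphism close to the identity which moves finitely many points to nearby prescribed
positions, as a composition of two shears in transversal directions. -/
theorem exists_homeomorph_interpolation [LocallyConvexSpace ℝ X] {f l : X →L[ℝ] ℝ} {u : X}
    (hfu : f u = 1) (hlu : l u = 0) {U : Set X} (hU : U ∈ 𝓝 (0 : X)) :
    ∃ U₀ ∈ 𝓝 (0 : X), ∀ {ι : Type} (F : Finset ι) (p q : ι → X),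
      (∀ i ∈ F, p i - q i ∈ U₀) → Set.InjOn (fun i => f (p i)) F →
      Set.InjOn (fun i => l (q i)) F →
      ∃ h : X ≃ₜ X, (∀ x, x - h x ∈ U) ∧ ∀ i ∈ F, h (p i) = q i := by
  have hadd : Filter.Tendsto (fun z : X × X => -(z.1 + z.2)) (𝓝 0 ×ˢ 𝓝 0) (𝓝 0) := by
    have : Continuous fun z : X × X => -(z.1 + z.2) := by fun_prop
    simpa [nhds_prod_eq] using this.tendsto (0, 0)
  obtain ⟨N', hN', hN'U⟩ := Filter.mem_prod_same_iff.1 (hadd hU)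
  obtain ⟨N, ⟨hN, hNc⟩, hNN'⟩ := (LocallyConvexSpace.convex_basis_zero ℝ X).mem_iff.1 hN'
  have hsum : ∀ v ∈ N, ∀ w ∈ N, -(v + w) ∈ U := fun v hv w hw =>
    hN'U (Set.mk_mem_prod (hNN' hv) (hNN' hw))
  obtain ⟨δ, hδ, hδN⟩ := exists_smul_mem_of_mem_nhds_zero hN u
  -- With `e = p i - q i`, the first shear adds `f e • u - e`, which lies in `ker f`, and lands at
  -- `q i + f e • u`. The second runs along `u` and is controlled by `l`, which is blind to `u` and
  -- so reads `l (q i)`; it removes `f e • u`.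
  have h1 : ∀ᶠ e in 𝓝 (0 : X), f e • u - e ∈ N := by
    have : Continuous fun e : X => f e • u - e := by fun_prop
    exact this.continuousAt.eventually_mem (by simpa using hN)
  have h2 : ∀ᶠ e in 𝓝 (0 : X), |f e| < δ := by
    have : Continuous fun e : X => |f e| := by fun_prop
    exact this.continuousAt.eventually_lt continuousAt_const (by simpa using hδ)
  refine ⟨_, h1.and h2, fun {ι} F p q hpq hp hq => ?_⟩
  have hker : Convex ℝ {x : X | f x = 0} :=
    (convex_singleton (0 : ℝ)).linear_preimage f.toLinearMap
  obtain ⟨g, hg, hgC, hgF⟩ := exists_continuous_interpolation (hNc.inter hker)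
    ⟨0, mem_of_mem_nhds hN, by simp⟩ F (fun i => f (p i))
    (fun i => f (p i - q i) • u - (p i - q i)) hp
    fun i hi => ⟨(hpq i hi).1, by simp [hfu]⟩
  obtain ⟨c, hc, hcC, hcF⟩ := exists_continuous_interpolation (convex_ball (0 : ℝ) δ)
    ⟨0, by simpa using hδ⟩ F (fun i => l (q i)) (fun i => -f (p i - q i)) hq
    fun i hi => by simpa [abs_sub_comm] using (hpq i hi).2
  refine ⟨(shear f g hg fun t => (hgC t).2).trans
    (shear l (fun t => c t • u) (by fun_prop) fun t => by simp [hlu]), fun x => ?_,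
    fun i hi => ?_⟩
  · simp only [Homeomorph.trans_apply, shear_apply]
    convert hsum _ (hgC (f x)).1 _ (hδN (c (l (x + g (f x)))) (by simpa using hcC _)) using 1
    abel
  · have hl : l (p i + g (f (p i))) = l (q i) := by
      rw [hgF i hi]
      simp [hlu]
    simp only [Homeomorph.trans_apply, shear_apply, hl]
    rw [hgF i hi, hcF i hi, neg_smul]
    abel

theorem eventually_add_mul_ne_zero (a : ℝ) {b : ℝ} (hb : b ≠ 0) :
    ∀ᶠ t in 𝓝[≠] (0 : ℝ), a + t * b ≠ 0 := by
  by_cases ha : a = 0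
  · filter_upwards [self_mem_nhdsWithin] with t ht
    simpa [ha, hb] using ht
  · apply Filter.Eventually.filter_mono nhdsWithin_le_nhds
    have : Continuous fun t : ℝ => a + t * b := by fun_prop
    exact this.continuousAt.eventually_ne (by simpa using ha)

/-- Each difference of two values is affine in `t` with nonzero slope, so it has a single zero, and
there are finitely many pairs. -/
theorem eventually_injOn_perturbation {f : X →L[ℝ] ℝ} {w : X} (hw : f w ≠ 0) (x : ℕ → X)
    (m : ℕ) :
    ∀ᶠ t in 𝓝[≠] (0 : ℝ), Set.InjOn (fun j : ℕ => f (x j + (t * (j : ℝ)) • w)) (Finset.range m) := by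
  have : ∀ᶠ t in 𝓝[≠] (0 : ℝ), ∀ i ∈ Finset.range m, ∀ j ∈ Finset.range m, i ≠ j →
      (f (x i) - f (x j)) + t * (((i : ℝ) - j) * f w) ≠ 0 := by
    simp_rw [Filter.eventually_all_finset, Filter.eventually_imp_distrib_left]
    intro i _ j _ hij
    exact eventually_add_mul_ne_zero _ (mul_ne_zero (sub_ne_zero.2 (by exact_mod_cast hij)) hw)
  filter_upwards [this] with t ht i hi j hj hij
  by_contra hne
  refine ht i hi j hj hne ?_
  simp only [map_add, map_smul, smul_eq_mul] at hij
  linear_combination hij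

/-- A finite family can be perturbed so that two given nonzero functionals separate it. -/
theorem exists_injOn_perturbation {f l : X →L[ℝ] ℝ} (hf : f ≠ 0) (hl : l ≠ 0) {W : Set X}
    (hW : W ∈ 𝓝 (0 : X)) (x : ℕ → X) (m : ℕ) :
    ∃ y : ℕ → X, (∀ j < m, y j - x j ∈ W) ∧ Set.InjOn (fun j => f (y j)) (Finset.range m) ∧
      Set.InjOn (fun j => l (y j)) (Finset.range m) := by
  obtain ⟨w, hfw, hlw⟩ : ∃ w, f w ≠ 0 ∧ l w ≠ 0 := by
    obtain ⟨a, ha⟩ := DFunLike.ne_iff.1 hf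
    obtain ⟨b, hb⟩ := DFunLike.ne_iff.1 hl
    simp only [zero_apply] at ha hb
    by_cases hla : l a = 0
    · by_cases hfb : f b = 0
      · exact ⟨a + b, by simpa [hfb], by simpa [hla]⟩
      · exact ⟨b, hfb, hb⟩
    · exact ⟨a, ha, hla⟩
  have hsmall : ∀ᶠ t in 𝓝[≠] (0 : ℝ), ∀ j ∈ Finset.range m, (t * (j : ℝ)) • w ∈ W := by
    rw [Filter.eventually_all_finset]
    intro j _
    apply Filter.Eventually.filter_mono nhdsWithin_le_nhds
    have : Continuous fun t : ℝ => (t * (j : ℝ)) • w := by fun_prop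
    exact this.continuousAt.eventually_mem (by simpa using hW)
  obtain ⟨t, ht, h1, h2⟩ := (hsmall.and ((eventually_injOn_perturbation hfw x m).and
    (eventually_injOn_perturbation hlw x m))).exists
  exact ⟨fun j => x j + (t * j) • w, fun j hj => by simpa using ht j (by simpa using hj), h1, h2⟩

/-- The homeomorphism stretching the line with coordinate `f` and direction `u` by a bounded
amount. -/
noncomputable def stretch (f : X →L[ℝ] ℝ) (u : X) (hu : f u = 1) (ε : ℝ) (hε : 0 < ε) : X ≃ₜ X where
  toFun x := x + (max (-ε) (min (f x) ε)) • u
  -- The coordinate is doubled on `[-ε, ε]` and moved outward by `ε` elsewhere, hence the halving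
  -- here.
  invFun x := x - (max (-ε) (min (f x / 2) ε)) • u
  left_inv x := by
    have : max (-ε) (min ((f x + max (-ε) (min (f x) ε)) / 2) ε) = max (-ε) (min (f x) ε) := by
      grind
    simp [hu, this]
  right_inv x := by
    have : max (-ε) (min (f x - max (-ε) (min (f x / 2) ε)) ε) = max (-ε) (min (f x / 2) ε) := by
      grind
    simp [hu, this]
  continuous_toFun := by fun_prop
  continuous_invFun := by fun_prop

theorem stretch_apply (f : X →L[ℝ] ℝ) (u : X) (hu : f u = 1) (ε : ℝ) (hε : 0 < ε) (x : X) :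
    stretch f u hu ε hε x = x + (max (-ε) (min (f x) ε)) • u := rfl

end RealSpace

/-! ### From stability to shadowing -/

section Stability

variable {𝕜 X : Type*} [RCLike 𝕜] [AddCommGroup X] [Module 𝕜 X] [Module ℝ X]
  [IsScalarTower ℝ 𝕜 X] [TopologicalSpace X] [IsTopologicalAddGroup X] [ContinuousSMul ℝ X]

/-- In real dimension at least two, the pseudo-orbits of a topologically stable operator along
any injective partial map of a finite index set are shadowed by true orbits. -/
theorem TopologicallyStable.exists_shadow [LocallyConvexSpace ℝ X] {T : X ≃L[𝕜] X}
    (hT : TopologicallyStable T) {f l : X →L[ℝ] ℝ} {u : X} (hfu : f u = 1) (hlu : l u = 0)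
    (hl : l ≠ 0) {V : Set X} (hV : V ∈ 𝓝 (0 : X)) :
    ∃ U ∈ 𝓝 (0 : X), ∀ (m : ℕ) (F : Finset ℕ) (σ : ℕ → ℕ) (x : ℕ → X), Set.InjOn σ F →
      (∀ j ∈ F, j < m ∧ σ j < m) → (∀ j ∈ F, T (x j) - x (σ j) ∈ U) →
      ∃ y : ℕ → X, (∀ j ∈ F, T (y j) = y (σ j)) ∧ ∀ j < m, x j - y j ∈ V := by
  have hsub : Filter.Tendsto (fun z : X × X => -z.1 - z.2) (𝓝 0 ×ˢ 𝓝 0) (𝓝 0) := by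
    have : Continuous fun z : X × X => -z.1 - z.2 := by fun_prop
    simpa [nhds_prod_eq] using this.tendsto (0, 0)
  obtain ⟨V₀, hV₀, hV₀V⟩ := Filter.mem_prod_same_iff.1 (hsub hV)
  obtain ⟨U₁, hU₁, hS⟩ := hT V₀ hV₀
  obtain ⟨U₂, hU₂, hh⟩ := exists_homeomorph_interpolation hfu hlu hU₁
  have hcomb : Filter.Tendsto (fun z : X × X × X => z.1 + (T z.2.1 - z.2.2))
      (𝓝 0 ×ˢ 𝓝 0) (𝓝 0) := by
    have : Continuous fun z : X × X × X => z.1 + (T z.2.1 - z.2.2) := by fun_prop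
    have h := this.tendsto (0, 0)
    rw [nhds_prod_eq] at h
    simpa using h
  obtain ⟨U, hU, P, hP, hUP⟩ := Filter.mem_prod_iff.1 (hcomb hU₂)
  rw [Prod.zero_eq_mk, nhds_prod_eq] at hP
  obtain ⟨W, hW, hWP⟩ := Filter.mem_prod_same_iff.1 hP
  -- The points to be moved are `T (x' j)`, so `f ∘ T` must separate the `x' j`; `l` must separate
  -- the targets.
  let fT : X →L[ℝ] ℝ := f.comp ((T : X →L[𝕜] X).restrictScalars ℝ)
  have hfT : fT ≠ 0 := fun h => by
    have := DFunLike.congr_fun h (T.symm u)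
    simp [fT, hfu] at this
  refine ⟨U, hU, fun m F σ x hσ hF hx => ?_⟩
  obtain ⟨x', hx', hinj, hinjl⟩ :=
    exists_injOn_perturbation hfT hl (Filter.inter_mem hV₀ hW) x m
  obtain ⟨h, hhU, hhF⟩ := hh F (fun j => T (x' j)) (fun j => x' (σ j))
    (fun j hj => by
      have := hUP (Set.mk_mem_prod (hx j hj) (hWP (Set.mk_mem_prod (hx' j (hF j hj).1).2
        (hx' (σ j) (hF j hj).2).2)))
      rw [show T (x' j) - x' (σ j) = (T (x j) - x (σ j)) +
        (T (x' j - x j) - (x' (σ j) - x (σ j))) by rw [map_sub]; abel]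
      exact this)
    (hinj.mono fun j hj => by simpa using (hF j hj).1)
    (fun i hi j hj hij => hσ hi hj
      (hinjl (by simpa using (hF i hi).2) (by simpa using (hF j hj).2) hij))
  obtain ⟨φ, -, hφT, hφ⟩ := hS (T.toHomeomorph.trans h) fun x => by simpa using hhU (T x)
  refine ⟨fun j => φ (x' j), fun j hj => ?_, fun j hj => ?_⟩
  · simp [hφT, hhF j hj]
  · rw [show x j - φ (x' j) = -(x' j - x j) - (φ (x' j) - x' j) by abel]
    exact hV₀V (Set.mk_mem_prod (hx' j hj).1 (hφ (x' j)))

variable {T : X ≃L[𝕜] X} {f : X →L[ℝ] ℝ} {u : X} {c : ℝ}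

theorem TopologicallyStable.finiteShadowingProperty [LocallyConvexSpace ℝ X]
    (hT : TopologicallyStable T) {l : X →L[ℝ] ℝ} (hfu : f u = 1) (hlu : l u = 0) (hl : l ≠ 0) :
    FiniteShadowingProperty (T : X →L[𝕜] X) := by
  intro V hV
  obtain ⟨U, hU, h⟩ := hT.exists_shadow hfu hlu hl hV
  refine ⟨U, hU, fun k x hx => ?_⟩
  obtain ⟨y, hy, hxy⟩ := h (k + 1) (Finset.range k) Nat.succ x Nat.succ_injective.injOn
    (fun j hj => by simp at hj; omega) fun j hj => hx.2 j (by simpa using hj)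
  have horb : ∀ j ≤ k, (T : X →L[𝕜] X)^[j] (y 0) = y j := by
    intro j
    induction j with
    | zero => simp
    | succ j ih =>
      intro hj
      rw [Function.iterate_succ_apply', ih (by omega)]
      exact hy j (by simp; omega)
  exact ⟨y 0, fun j hj => by rw [horb j hj]; exact hxy j (by omega)⟩

theorem TopologicallyStable.strictPeriodicShadowingProperty [LocallyConvexSpace ℝ X]
    (hT : TopologicallyStable T) {l : X →L[ℝ] ℝ} (hfu : f u = 1) (hlu : l u = 0) (hl : l ≠ 0) :
    StrictPeriodicShadowingProperty (T : X →L[𝕜] X) := by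
  intro V hV
  obtain ⟨U, hU, h⟩ := hT.exists_shadow hfu hlu hl hV
  refine ⟨U, hU, fun k x hk hx hper => ?_⟩
  have hmod : ∀ j, x (j % k) = x j := fun j => Function.Periodic.map_mod_nat hper j
  obtain ⟨y, hy, hxy⟩ := h k (Finset.range k) (fun j => (j + 1) % k) x
    (fun i hi j hj hij => by
      have : i ≡ j [MOD k] := Nat.ModEq.add_right_cancel' 1 hij
      exact this.eq_of_lt_of_lt (by simpa using hi) (by simpa using hj))
    (fun j hj => ⟨by simpa using hj, Nat.mod_lt _ hk⟩) fun j _ => by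
      rw [hmod]
      exact hx j
  have horb : ∀ j, (T : X →L[𝕜] X)^[j] (y 0) = y (j % k) := by
    intro j
    induction j with
    | zero => simp
    | succ j ih =>
      rw [Function.iterate_succ_apply', ih]
      simpa using hy (j % k) (by simpa using Nat.mod_lt _ hk)
  refine ⟨y 0, by rw [horb, Nat.mod_self], fun j => ?_⟩
  rw [horb, ← hmod]
  exact hxy _ (Nat.mod_lt _ hk)

/-! ### The real line -/

theorem finiteShadowingProperty_of_line (hf : ∀ x, f x • u = x) (hfT : ∀ x, f (T x) = c * f x)
    (hc : |c| ≠ 1) : FiniteShadowingProperty (T : X →L[𝕜] X) := by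
  intro V hV
  obtain ⟨ρ, hρ, hρV⟩ := exists_smul_mem_of_mem_nhds_zero hV u
  have hδ : 0 < ρ / 2 * |(|c| - 1)| := by
    have := abs_pos.2 (sub_ne_zero.2 hc)
    positivity
  refine ⟨{e | |f e| < ρ / 2 * |(|c| - 1)|}, ?_, fun k x hx => ?_⟩
  · have : Continuous fun e : X => |f e| := by fun_prop
    exact this.continuousAt.eventually_lt continuousAt_const (by simpa using hδ)
  suffices ∃ a, ∀ j ≤ k, |f (x j - T^[j] a)| ≤ ρ / 2 by
    obtain ⟨a, ha⟩ := this
    refine ⟨a, fun j hj => ?_⟩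
    rw [← hf (x j - _)]
    exact hρV _ ((ha j hj).trans_lt (by linarith))
  have hstep : ∀ a, ∀ j < k, |c * f (x j - T^[j] a) - f (x (j + 1) - T^[j + 1] a)| <
      ρ / 2 * |(|c| - 1)| := fun a j hj => by
    have h : |f (T (x j) - x (j + 1))| < ρ / 2 * |(|c| - 1)| := hx.2 j hj
    convert h using 2
    simp only [map_sub, Function.iterate_succ_apply', hfT]
    ring
  -- The bound `ρ / 2` on the error propagates forward from `x 0` if `T` contracts, backward from `x
  -- k` if it expands.
  rcases lt_or_gt_of_ne hc with hc | hc
  · rw [abs_of_neg (by linarith)] at hstep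
    refine ⟨x 0, fun j => ?_⟩
    induction j with
    | zero => simp; linarith
    | succ j ih =>
      intro hj
      have h1 := hstep (x 0) j (by omega)
      have h2 := abs_sub_abs_le_abs_sub (f (x (j + 1) - T^[j + 1] (x 0)))
        (c * f (x j - T^[j] (x 0)))
      rw [abs_sub_comm, abs_mul] at h2
      have h3 := mul_le_mul_of_nonneg_left (ih (by omega)) (abs_nonneg c)
      linarith
  · rw [abs_of_pos (by linarith)] at hstep
    have hlast : T^[k] (T.symm^[k] (x k)) = x k :=
      Function.LeftInverse.iterate T.apply_symm_apply k (x k)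
    refine ⟨T.symm^[k] (x k), fun j hj => ?_⟩
    induction hj using Nat.decreasingInduction with
    | self => simp [hlast]; linarith
    | of_succ j hj ih =>
      have h1 := hstep (T.symm^[k] (x k)) j hj
      have h2 := abs_sub_abs_le_abs_sub (c * f (x j - T^[j] (T.symm^[k] (x k))))
        (f (x (j + 1) - T^[j + 1] (T.symm^[k] (x k))))
      rw [abs_mul] at h2
      refine le_of_mul_le_mul_left (a := |c|) ?_ (by linarith)
      linarith

theorem strictPeriodicShadowingProperty_of_line (hf : ∀ x, f x • u = x)
    (hfT : ∀ x, f (T x) = c * f x) (hc : |c| ≠ 1) :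
    StrictPeriodicShadowingProperty (T : X →L[𝕜] X) := by
  intro V hV
  obtain ⟨ρ, hρ, hρV⟩ := exists_smul_mem_of_mem_nhds_zero hV u
  have hδ : 0 < ρ / 2 * |(|c| - 1)| := by
    have := abs_pos.2 (sub_ne_zero.2 hc)
    positivity
  refine ⟨{e | |f e| < ρ / 2 * |(|c| - 1)|}, ?_, fun k x hk hx hper => ?_⟩
  · have : Continuous fun e : X => |f e| := by fun_prop
    exact this.continuousAt.eventually_lt continuousAt_const (by simpa using hδ)
  have hfix : ∀ j, (T : X →L[𝕜] X)^[j] 0 = 0 := fun j =>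
    Function.iterate_fixed (map_zero (T : X →L[𝕜] X)) j
  suffices ∀ j, |f (x j)| ≤ ρ / 2 by
    refine ⟨0, hfix k, fun j => ?_⟩
    rw [hfix, sub_zero, ← hf (x j)]
    exact hρV _ ((this j).trans_lt (by linarith))
  -- The orbit of `0` shadows: at a maximal term, compare with its predecessor (index `i + k - 1`)
  -- if `|c| < 1`, with its successor if `|c| > 1`.
  obtain ⟨i, -, hi⟩ := Finset.exists_max_image (Finset.range k) (fun j => |f (x j)|)
    ⟨0, by simpa using Nat.lt_of_succ_le hk⟩
  have hmax : ∀ j, |f (x j)| ≤ |f (x i)| := fun j => by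
    rw [← Function.Periodic.map_mod_nat hper j]
    exact hi _ (by simpa using Nat.mod_lt _ hk)
  have hstep : ∀ j, |c * f (x j) - f (x (j + 1))| < ρ / 2 * |(|c| - 1)| := fun j => by
    simpa [hfT] using hx j
  refine fun j => (hmax j).trans ?_
  rcases lt_or_gt_of_ne hc with hc | hc
  · have h1 := hstep (i + k - 1)
    rw [abs_of_neg (a := |c| - 1) (sub_neg.2 hc), show i + k - 1 + 1 = i + k by omega, hper] at h1
    have h2 := abs_sub_abs_le_abs_sub (f (x i)) (c * f (x (i + k - 1)))
    rw [abs_sub_comm, abs_mul] at h2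
    have h3 := mul_le_mul_of_nonneg_left (hmax (i + k - 1)) (abs_nonneg c)
    refine le_of_mul_le_mul_left (a := 1 - |c|) ?_ (by linarith)
    linarith
  · have h1 := hstep i
    rw [abs_of_pos (a := |c| - 1) (sub_pos.2 hc)] at h1
    have h2 := abs_sub_abs_le_abs_sub (c * f (x i)) (f (x (i + 1)))
    rw [abs_mul] at h2
    have h3 := hmax (i + 1)
    refine le_of_mul_le_mul_left (a := |c| - 1) ?_ (by linarith)
    linarith

/-- A topologically stable operator on a real line is hyperbolic. -/
theorem TopologicallyStable.abs_ne_one_of_line (hT : TopologicallyStable T) (hfu : f u = 1)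
    (hfT : ∀ x, f (T x) = c * f x) : |c| ≠ 1 := by
  intro hc
  have hV : {x : X | |f x| < 1} ∈ 𝓝 0 := by
    have : Continuous fun e : X => |f e| := by fun_prop
    exact this.continuousAt.eventually_lt continuousAt_const (by simp)
  obtain ⟨U, hU, hS⟩ := hT _ hV
  obtain ⟨δ, hδ, hδU⟩ := exists_smul_mem_of_mem_nhds_zero hU u
  have hε : 0 < δ / 2 := by positivity
  -- If `|c| = 1`, orbits of the stretched map escape linearly, while `|f ∘ φ|` is constant along
  -- them; yet `φ` is at bounded distance from the identity.
  obtain ⟨φ, -, hφT, hφ⟩ := hS (T.toHomeomorph.trans (stretch f u hfu (δ / 2) hε)) fun x => by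
    convert hδU (-max (-(δ / 2)) (min (f (T x)) (δ / 2))) (by grind) using 1
    simp [stretch_apply]
  set S := T.toHomeomorph.trans (stretch f u hfu (δ / 2) hε)
  have hSf : ∀ x, |f (S x)| = |f x| + min |f x| (δ / 2) := fun x => by
    have h1 : |f (T x)| = |f x| := by rw [hfT, abs_mul, hc, one_mul]
    have h2 : f (S x) = f (T x) + max (-(δ / 2)) (min (f (T x)) (δ / 2)) := by
      simp [S, stretch_apply, hfu]
    rw [h2, ← h1]
    grind
  have hgrow : ∀ n : ℕ, δ / 2 + n * (δ / 2) ≤ |f (S^[n] ((δ / 2) • u))| := by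
    intro n
    induction n with
    | zero => simp [hfu, abs_of_pos hε]
    | succ n ih =>
      have h0 : 0 ≤ n * (δ / 2) := by positivity
      rw [Function.iterate_succ_apply', hSf, min_eq_right (by linarith)]
      push_cast
      linarith
  have hbdd : ∀ n : ℕ, |f (φ (S^[n] ((δ / 2) • u)))| = |f (φ ((δ / 2) • u))| := by
    intro n
    induction n with
    | zero => rfl
    | succ n ih => rw [Function.iterate_succ_apply', ← hφT, hfT, abs_mul, hc, one_mul, ih]
  obtain ⟨n, hn⟩ := exists_nat_gt ((|f (φ ((δ / 2) • u))| + 1) / (δ / 2))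
  rw [div_lt_iff₀ hε] at hn
  have h1 : |f (φ (S^[n] ((δ / 2) • u)) - S^[n] ((δ / 2) • u))| < 1 := hφ _
  rw [map_sub, abs_sub_comm] at h1
  have h2 := abs_sub_abs_le_abs_sub (f (S^[n] ((δ / 2) • u))) (f (φ (S^[n] ((δ / 2) • u))))
  linarith [hgrow n, hbdd n]

end Stability

end LinearDynamics

theorem theorem3p1 {𝕜 X : Type*} [RCLike 𝕜] [AddCommGroup X] [Module 𝕜 X]
    [Module ℝ X] [IsScalarTower ℝ 𝕜 X] [TopologicalSpace X] [IsTopologicalAddGroup X]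
    [ContinuousSMul 𝕜 X] [LocallyConvexSpace ℝ X] [T2Space X]
    (T : X ≃L[𝕜] X) (hT : LinearDynamics.TopologicallyStable T) :
    LinearDynamics.FiniteShadowingProperty (T : X →L[𝕜] X) ∧
      LinearDynamics.StrictPeriodicShadowingProperty (T : X →L[𝕜] X) := by
  have : ContinuousSMul ℝ X := IsScalarTower.continuousSMul 𝕜
  rcases subsingleton_or_nontrivial X with hX | hX
  · refine ⟨fun V hV => ⟨V, hV, fun k x _ => ⟨0, fun j _ => ?_⟩⟩,
      fun V hV => ⟨V, hV, fun k x _ _ _ => ⟨0, Subsingleton.elim _ _, fun j => ?_⟩⟩⟩ <;>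
    · rw [Subsingleton.elim (x j - _) 0]
      exact mem_of_mem_nhds hV
  obtain ⟨u, hu⟩ := exists_ne (0 : X)
  obtain ⟨f, hfu⟩ := SeparatingDual.exists_eq_one (R := ℝ) hu
  by_cases hline : ∀ x, f x • u = x
  · have hfT : ∀ x, f (T x) = f (T u) * f x := fun x => by
      conv_lhs => rw [← hline x]
      rw [← ContinuousLinearEquiv.coe_coe, ContinuousLinearMap.map_smul_of_tower, map_smul,
        smul_eq_mul, mul_comm]
    have hc := hT.abs_ne_one_of_line hfu hfT
    exact ⟨LinearDynamics.finiteShadowingProperty_of_line hline hfT hc,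
      LinearDynamics.strictPeriodicShadowingProperty_of_line hline hfT hc⟩
  · push Not at hline
    obtain ⟨v, hv⟩ := hline
    obtain ⟨l, hl⟩ := SeparatingDual.exists_eq_one (R := ℝ) (sub_ne_zero.2 hv)
    -- The correction kills `u` but keeps the value `1` at `f v • u - v`, which lies in `ker f`.
    have hlu : (l - l u • f) u = 0 := by simp [hfu]
    have hl0 : l - l u • f ≠ 0 := fun h => by
      have := DFunLike.congr_fun h (f v • u - v)
      rw [sub_apply, hl] at this
      simp [hfu] at this
    exact ⟨hT.finiteShadowingProperty hfu hlu hl0, hT.strictPeriodicShadowingProperty hfu hlu hl0⟩
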